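/- Let $\mathbb{E}$ be a regular category, i.e. a category with finite limits in which regular epimorphisms are stable under pullback and every kernel pair has a coequalizer. For an object $Y$ of $\mathbb{E}$, let $\mathsf{Pt}_Y\mathbb{E}$ be the fibre above $Y$ of the fibration of points: its objects are the split epimorphisms $f\colon X\to Y$ equipped with a given section $s\colon Y\to X$ ($f s=1_Y$), and a morphism $(X,f,s)\to(\bar X,\bar f,\bar s)$ is a morphism $h\colon X\to\bar X$ with $\bar f h=f$ and $h s=\bar s$. For $q\colon Y'\to Y$, let $q^*\colon \mathsf{Pt}_Y\mathbb{E}\to\mathsf{Pt}_{Y'}\mathbb{E}$ be the base-change functor given by pullback along $q$. A functor $F\colon\mathbb{C}\to\mathbb{D}$ is called saturated on subobjects when for every object $X$ of $\mathbb{C}$ and every monomorphism $n\colon Z\to F(X)$ in $\mathbb{D}$ there are a monomorphism $m\colon W\to X$ in $\mathbb{C}$ and an isomorphism $e\colon Z\to F(W)$ such that $F(m)\,e=n$. Theorem. The regular category $\mathbb{E}$ is a Mal'tsev category (i.e. it is finitely complete and every internal reflexive relation in $\mathbb{E}$ is an internal equivalence relation) if and only if, for every regular epimorphism $q\colon Y'\to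 Y$ in $\mathbb{E}$, the functor $q^*\colon \mathsf{Pt}_Y\mathbb{E}\to\mathsf{Pt}_{Y'}\mathbb{E}$ is fully faithful and saturated on subobjects. -/

import Mathlib

open CategoryTheory CategoryTheory.Limits

universe v u v' u'

namespace MaltsevCat

/-- A category is a *Mal'tsev category* if it is finitely complete and every internal reflexive
relation (a jointly monic pair `p₁, p₂ : R ⟶ X` with a common section) is an internal equivalence
relation. -/
class IsMaltsev (E : Type u) [Category.{v} E] : Prop extends HasFiniteLimits E where
  isEquivalenceRelation : ∀ {R X : E} (p₁ p₂ : R ⟶ X),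
    ReflexiveRelation p₁ p₂ → IsEquivalenceRelation p₁ p₂

/-- An object of the fibre `Pt_Y(E)` of the fibration of points: a split epimorphism `f : X ⟶ Y`
equipped with a given section `s : Y ⟶ X`. -/
structure Pt {E : Type u} [Category.{v} E] (Y : E) where
  X : E
  f : X ⟶ Y
  s : Y ⟶ X
  s_f : s ≫ f = 𝟙 Y

namespace Pt

variable {E : Type u} [Category.{v} E]

attribute [simp] Pt.s_f

/-- A morphism of `Pt_Y(E)`: a morphism commuting with the split epimorphisms and with the given
sections (so lying over the identity of `Y`). -/
@[ext]
structure Hom {Y : E} (P Q : Pt Y) where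
  hom : P.X ⟶ Q.X
  hom_f : hom ≫ Q.f = P.f
  s_hom : P.s ≫ hom = Q.s

attribute [simp] Hom.hom_f Hom.s_hom

instance (Y : E) : Category.{v} (Pt Y) where
  Hom P Q := Hom P Q
  id P := { hom := 𝟙 P.X, hom_f := by simp, s_hom := by simp }
  comp {P Q R} g h :=
    { hom := Hom.hom g ≫ Hom.hom h
      hom_f := by rw [Category.assoc, Hom.hom_f, Hom.hom_f]
      s_hom := by rw [← Category.assoc, Hom.s_hom, Hom.s_hom] }
  id_comp g := Hom.ext (Category.id_comp (Hom.hom g))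
  comp_id g := Hom.ext (Category.comp_id (Hom.hom g))
  assoc g h k := Hom.ext (Category.assoc (Hom.hom g) (Hom.hom h) (Hom.hom k))

@[ext]
theorem hom_ext {Y : E} {P Q : Pt Y} {g h : P ⟶ Q} (w : Hom.hom g = Hom.hom h) : g = h :=
  Hom.ext w

@[simp]
theorem id_hom {Y : E} (P : Pt Y) : Hom.hom (𝟙 P) = 𝟙 P.X := rfl

@[simp]
theorem comp_hom {Y : E} {P Q R : Pt Y} (g : P ⟶ Q) (h : Q ⟶ R) :
    Hom.hom (g ≫ h) = Hom.hom g ≫ Hom.hom h := rfl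

variable [HasPullbacks E]

/-- The section of `X ×_Y Y' ⟶ Y'` induced by the section `s` of a point `(f, s)` over `Y`. -/
noncomputable def pullbackSection {Y' Y : E} (q : Y' ⟶ Y) (P : Pt Y) : Y' ⟶ pullback P.f q :=
  pullback.lift (q ≫ P.s) (𝟙 Y') (by simp)

@[simp]
theorem pullbackSection_fst {Y' Y : E} (q : Y' ⟶ Y) (P : Pt Y) :
    pullbackSection q P ≫ pullback.fst P.f q = q ≫ P.s :=
  pullback.lift_fst _ _ _

@[simp]
theorem pullbackSection_snd {Y' Y : E} (q : Y' ⟶ Y) (P : Pt Y) :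
    pullbackSection q P ≫ pullback.snd P.f q = 𝟙 Y' :=
  pullback.lift_snd _ _ _

/-- The morphism `g ×_Y Y'` between pullbacks induced by a morphism `g` of points over `Y`. -/
noncomputable def pullbackHom {Y' Y : E} (q : Y' ⟶ Y) {P Q : Pt Y} (g : P ⟶ Q) :
    pullback P.f q ⟶ pullback Q.f q :=
  pullback.lift (pullback.fst P.f q ≫ Hom.hom g) (pullback.snd P.f q)
    (by rw [Category.assoc, Hom.hom_f, pullback.condition])

@[simp]
theorem pullbackHom_fst {Y' Y : E} (q : Y' ⟶ Y) {P Q : Pt Y} (g : P ⟶ Q) :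
    pullbackHom q g ≫ pullback.fst Q.f q = pullback.fst P.f q ≫ Hom.hom g :=
  pullback.lift_fst _ _ _

@[simp]
theorem pullbackHom_snd {Y' Y : E} (q : Y' ⟶ Y) {P Q : Pt Y} (g : P ⟶ Q) :
    pullbackHom q g ≫ pullback.snd Q.f q = pullback.snd P.f q :=
  pullback.lift_snd _ _ _

theorem pullbackSection_pullbackHom {Y' Y : E} (q : Y' ⟶ Y) {P Q : Pt Y} (g : P ⟶ Q) :
    pullbackSection q P ≫ pullbackHom q g = pullbackSection q Q := by
  apply pullback.hom_ext
  · rw [Category.assoc, pullbackHom_fst, ← Category.assoc, pullbackSection_fst, Category.assoc,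
      Hom.s_hom, pullbackSection_fst]
  · rw [Category.assoc, pullbackHom_snd, pullbackSection_snd, pullbackSection_snd]

theorem pullbackHom_id {Y' Y : E} (q : Y' ⟶ Y) (P : Pt Y) :
    pullbackHom q (𝟙 P) = 𝟙 (pullback P.f q) := by
  apply pullback.hom_ext
  · rw [pullbackHom_fst, id_hom, Category.comp_id, Category.id_comp]
  · rw [pullbackHom_snd, Category.id_comp]

theorem pullbackHom_comp {Y' Y : E} (q : Y' ⟶ Y) {P Q R : Pt Y} (g : P ⟶ Q) (h : Q ⟶ R) :
    pullbackHom q (g ≫ h) = pullbackHom q g ≫ pullbackHom q h := by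
  apply pullback.hom_ext
  · rw [pullbackHom_fst, comp_hom, Category.assoc, pullbackHom_fst, ← Category.assoc,
      ← Category.assoc, pullbackHom_fst]
  · rw [pullbackHom_snd, Category.assoc, pullbackHom_snd, pullbackHom_snd]

/-- The base-change functor `q^* : Pt_Y(E) ⥤ Pt_{Y'}(E)` of the fibration of points along
`q : Y' ⟶ Y`, obtained by pullback along `q`. -/
noncomputable def baseChange {Y' Y : E} (q : Y' ⟶ Y) : Pt Y ⥤ Pt Y' where
  obj P :=
    { X := pullback P.f q
      f := pullback.snd P.f q
      s := pullbackSection q P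
      s_f := pullbackSection_snd q P }
  map g :=
    { hom := pullbackHom q g
      hom_f := pullbackHom_snd q g
      s_hom := pullbackSection_pullbackHom q g }
  map_id P := hom_ext (pullbackHom_id q P)
  map_comp g h := hom_ext (pullbackHom_comp q g h)

end Pt

/-- A functor `F` is *saturated on subobjects* if every monomorphism `n : Z ⟶ F X` is, up to
isomorphism (of subobjects of `F X`), the image under `F` of a monomorphism `m : W ⟶ X`. -/
def SaturatedOnSubobjects {C : Type u} [Category.{v} C] {D : Type u'} [Category.{v'} D]
    (F : C ⥤ D) : Prop :=
  ∀ (X : C) (Z : D) (n : Z ⟶ F.obj X), Mono n →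
    ∃ (W : C) (m : W ⟶ X) (e : Z ≅ F.obj W), Mono m ∧ e.hom ≫ F.map m = n

end MaltsevCat

/-!
In a Mal'tsev category every relation `R` is difunctional: apply symmetry to the reflexive relation
on `R` consisting of the pairs `(w₁, w₂)` such that the source of `w₁` is related to the target
of `w₂`. A subobject `Z` of the base change `q^* P` along a regular epimorphism descends to its
image `W` in `P`: the span `W ⟵ Z ⟶ Y'` is a relation, and its difunctionality makes `Z` the
pullback of `W` along `q`. Since `q^*` preserves binary products and reflects isomorphisms, fullness
follows by descending graphs of morphisms as subobjects of products.

Conversely, given a relation `(p, q)` from `A` to `B`, consider the subobject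
`{((p r, p r'), r) | q r = q r'}` of the base change along `p` of the point `A × A ⟶ A`. If it
descends to `A × A`, then whether `((a, a'), r)` belongs to it depends on `r` only through `p r`,
which is difunctionality of `(p, q)`. A reflexive relation that is difunctional is an equivalence
relation, and its first projection `p` is a split epimorphism, hence a regular one.
-/

namespace MaltsevCat

variable {E : Type u} [Category.{v} E]

attribute [local simp] pullback.lift_fst pullback.lift_snd pullback.lift_fst_assoc
  pullback.lift_snd_assoc prod.lift_fst prod.lift_snd

/-- Difunctionality of a span `p : R ⟶ A`, `q : R ⟶ B`, in terms of generalized elements: if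
`a R b`, `a' R b` and `a' R b'`, then `a R b'`. -/
def Difunctional {R A B : E} (p : R ⟶ A) (q : R ⟶ B) : Prop :=
  ∀ ⦃T : E⦄ (w₁ w₂ w₃ : T ⟶ R), w₁ ≫ q = w₂ ≫ q → w₂ ≫ p = w₃ ≫ p →
    ∃ w : T ⟶ R, w ≫ p = w₁ ≫ p ∧ w ≫ q = w₃ ≫ q

theorem Difunctional.isEquivalenceRelation [HasPullbacks E] {R X : E} {p₁ p₂ : R ⟶ X}
    (hd : Difunctional p₁ p₂) (h : ReflexiveRelation p₁ p₂) : IsEquivalenceRelation p₁ p₂ := by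
  obtain ⟨s, hs₁, hs₂⟩ := hd (p₂ ≫ h.r) (𝟙 R) (p₁ ≫ h.r) (by simp) (by simp)
  obtain ⟨t, ht₁, ht₂⟩ := hd (pullback.fst p₂ p₁) (pullback.fst p₂ p₁ ≫ p₂ ≫ h.r)
    (pullback.snd p₂ p₁) (by simp) (by simp [pullback.condition])
  exact ⟨⟨{ h with
    s := s
    symmetry₁ := by simpa using hs₁
    symmetry₂ := by simpa using hs₂
    c := _
    isLimit := pullback.isLimit p₂ p₁
    t := t
    transitivity₁ := ht₁
    transitivity₂ := ht₂ }⟩⟩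

/-- The relation on `R` relating `w₁` to `w₂` when `p w₁` is related to `q w₂` by the span `(p, q)`:
the object of triples `(l, w₁, w₂)` with `p l = p w₁` and `q l = q w₂`. -/
noncomputable abbrev crossRelation [HasFiniteLimits E] {R A B : E} (p : R ⟶ A) (q : R ⟶ B) : E :=
  pullback (prod.lift p q) (prod.map p q)

namespace crossRelation

variable [HasFiniteLimits E] {R A B : E} (p : R ⟶ A) (q : R ⟶ B)

/-- The element `l` of a triple `(l, w₁, w₂)`, which witnesses that `p w₁` is related to `q w₂`. -/
noncomputable def witness : crossRelation p q ⟶ R := pullback.fst _ _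

/-- The element `w₁` of a triple `(l, w₁, w₂)`. -/
noncomputable def fst : crossRelation p q ⟶ R := pullback.snd _ _ ≫ prod.fst

/-- The element `w₂` of a triple `(l, w₁, w₂)`. -/
noncomputable def snd : crossRelation p q ⟶ R := pullback.snd _ _ ≫ prod.snd

theorem witness_comp_left : witness p q ≫ p = fst p q ≫ p := by
  simpa [witness, fst] using
    pullback.condition (f := prod.lift p q) (g := prod.map p q) =≫ prod.fst

theorem witness_comp_right : witness p q ≫ q = snd p q ≫ q := by
  simpa [witness, snd] using
    pullback.condition (f := prod.lift p q) (g := prod.map p q) =≫ prod.snd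

theorem exists_lift {T : E} (l w₁ w₂ : T ⟶ R) (hp : l ≫ p = w₁ ≫ p) (hq : l ≫ q = w₂ ≫ q) :
    ∃ z : T ⟶ crossRelation p q, z ≫ fst p q = w₁ ∧ z ≫ snd p q = w₂ :=
  ⟨pullback.lift l (prod.lift w₁ w₂) (by ext <;> simp [hp, hq]), by simp [fst], by simp [snd]⟩

instance jointlyMono₂ [JointlyMono₂ p q] : JointlyMono₂ (fst p q) (snd p q) where
  right_cancellation T x y h₁ h₂ := by
    have hl : x ≫ witness p q = y ≫ witness p q := by
      refine JointlyMono₂.right_cancellation (p₁ := p) (p₂ := q) _ _ ?_ ?_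
      · simp only [Category.assoc, witness_comp_left, reassoc_of% h₁]
      · simp only [Category.assoc, witness_comp_right, reassoc_of% h₂]
    refine pullback.hom_ext hl (Limits.prod.hom_ext ?_ ?_)
    · simpa [fst] using h₁
    · simpa [snd] using h₂

theorem nonempty_reflexiveRelation [JointlyMono₂ p q] :
    Nonempty (ReflexiveRelation (fst p q) (snd p q)) := by
  obtain ⟨r, hr₁, hr₂⟩ := exists_lift p q (𝟙 R) (𝟙 R) (𝟙 R) rfl rfl
  exact ⟨⟨inferInstance, r, hr₁, hr₂⟩⟩

end crossRelation

theorem IsMaltsev.difunctional [IsMaltsev E] {R A B : E} (p : R ⟶ A) (q : R ⟶ B)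
    [JointlyMono₂ p q] : Difunctional p q := by
  intro T w₁ w₂ w₃ hq hp
  obtain ⟨hrefl⟩ := crossRelation.nonempty_reflexiveRelation p q
  obtain ⟨⟨equiv⟩⟩ := IsMaltsev.isEquivalenceRelation _ _ hrefl
  obtain ⟨z, hz₁, hz₂⟩ := crossRelation.exists_lift p q w₂ w₃ w₁ hp hq.symm
  refine ⟨z ≫ equiv.s ≫ crossRelation.witness p q, ?_, ?_⟩
  · simp only [Category.assoc, crossRelation.witness_comp_left, equiv.symmetry₁_assoc,
      reassoc_of% hz₂]
  · simp only [Category.assoc, crossRelation.witness_comp_right, equiv.symmetry₂_assoc,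
      reassoc_of% hz₁]

theorem Difunctional.isPullback [Regular E] {Z W Y' Y : E} {e : Z ⟶ W} {f : Z ⟶ Y'} {g : W ⟶ Y}
    {q : Y' ⟶ Y} {s : Y' ⟶ Z} {t : Y ⟶ W} [JointlyMono₂ e f] [IsRegularEpi e]
    (hd : Difunctional e f) (sq : CommSq e f g q) (hs : s ≫ f = 𝟙 Y') (hst : s ≫ e = q ≫ t) :
    IsPullback e f g q := by
  let i : Z ⟶ pullback g q := pullback.lift e f sq.w
  have hi₁ : i ≫ pullback.fst g q = e := pullback.lift_fst _ _ _
  have hi₂ : i ≫ pullback.snd g q = f := pullback.lift_snd _ _ _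
  have : Mono i := ⟨fun x y h => JointlyMono₂.right_cancellation (p₁ := e) (p₂ := f) _ _
    (by rw [← hi₁, reassoc_of% h]) (by rw [← hi₂, reassoc_of% h])⟩
  let a := pullback.fst e (pullback.fst g q)
  let c := pullback.snd e (pullback.fst g q)
  have hac : a ≫ e = c ≫ pullback.fst g q := pullback.condition
  have hq : a ≫ f ≫ q = c ≫ pullback.snd g q ≫ q := by
    rw [← sq.w, reassoc_of% hac, pullback.condition]
  -- A pair `(e a, y)` with `g (e a) = q y` belongs to the relation, by difunctionality applied to
  -- `e a ∼ f a`, `t (q y) ∼ f a` and `t (q y) ∼ y`.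
  obtain ⟨w, hw₁, hw₂⟩ := hd a (a ≫ f ≫ s) (c ≫ pullback.snd g q ≫ s) (by simp [hs])
    (by simp only [Category.assoc, hst]; rw [reassoc_of% hq])
  have hwc : w ≫ i = c := by
    apply pullback.hom_ext
    · rw [Category.assoc, hi₁, hw₁, hac]
    · simp only [Category.assoc, hi₂, hw₂, hs, Category.comp_id]
  have : StrongEpi (w ≫ i) := hwc ▸ inferInstance
  have : StrongEpi i := strongEpi_of_strongEpi w i
  have : IsIso i := isIso_of_mono_of_strongEpi i
  exact IsPullback.of_iso_pullback sq (asIso i) hi₁ hi₂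

theorem SaturatedOnSubobjects.full {C : Type u} [Category.{v} C] {D : Type u'} [Category.{v'} D]
    {F : C ⥤ D} (hF : SaturatedOnSubobjects F) [HasBinaryProducts C]
    [PreservesLimitsOfShape (Discrete WalkingPair) F] [F.ReflectsIsomorphisms] : F.Full where
  map_surjective {X Y} g := by
    -- A subobject of `X ⨯ Y` lifting the graph of `g` is itself a graph.
    obtain ⟨graph, hgraph₁, hgraph₂⟩ := BinaryFan.IsLimit.lift'
      (isLimitOfHasBinaryProductOfPreservesLimit F X Y) (𝟙 (F.obj X)) g
    replace hgraph₁ : graph ≫ F.map prod.fst = 𝟙 (F.obj X) := hgraph₁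
    replace hgraph₂ : graph ≫ F.map prod.snd = g := hgraph₂
    have : Mono graph := mono_of_mono_fac hgraph₁
    obtain ⟨W, m, e, -, rfl⟩ := hF _ _ graph inferInstance
    have hfst : e.hom ≫ F.map (m ≫ prod.fst) = 𝟙 (F.obj X) := by simpa using hgraph₁
    have : IsIso (F.map (m ≫ prod.fst)) := by
      rw [← e.inv_comp_eq.2 hfst.symm, Category.comp_id]; infer_instance
    have : IsIso (m ≫ prod.fst) := isIso_of_reflects_iso _ F
    refine ⟨inv (m ≫ prod.fst) ≫ m ≫ prod.snd, ?_⟩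
    rw [F.map_comp, F.map_inv, IsIso.inv_comp_eq, ← cancel_epi e.hom, reassoc_of% hfst]
    simpa using hgraph₂

namespace Pt

instance isIso_hom {Y : E} {P Q : Pt Y} (h : P ⟶ Q) [IsIso h] : IsIso (Hom.hom h) :=
  ⟨Hom.hom (inv h), congrArg Hom.hom (IsIso.hom_inv_id h), congrArg Hom.hom (IsIso.inv_hom_id h)⟩

theorem isIso_of_isIso_hom {Y : E} {P Q : Pt Y} (h : P ⟶ Q) [IsIso (Hom.hom h)] : IsIso h :=
  ⟨Hom.mk (inv (Hom.hom h)) (by simp) (by simp),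
    hom_ext (IsIso.hom_inv_id _), hom_ext (IsIso.inv_hom_id _)⟩

theorem mono_of_mono_hom {Y : E} {P Q : Pt Y} (n : P ⟶ Q) [Mono (Hom.hom n)] : Mono n where
  right_cancellation _ _ w := hom_ext ((cancel_mono (Hom.hom n)).1 (congrArg Hom.hom w))

section HasPullbacks

variable [HasPullbacks E]

theorem mono_hom {Y : E} {P Q : Pt Y} (n : P ⟶ Q) [Mono n] : Mono (Hom.hom n) := by
  let K : Pt Y :=
    { X := pullback (Hom.hom n) (Hom.hom n)
      f := pullback.fst _ _ ≫ P.f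
      s := pullback.lift P.s P.s rfl
      s_f := by simp }
  let a : K ⟶ P := Hom.mk (pullback.fst _ _) rfl (by simp [K])
  let b : K ⟶ P := Hom.mk (pullback.snd _ _)
    (by simp only [K]; rw [← Hom.hom_f n, ← pullback.condition_assoc]) (by simp [K])
  have hab : a = b := (cancel_mono n).1 (hom_ext pullback.condition)
  exact (IsKernelPair.of_hasPullback _).mono_of_eq_fst_snd (congrArg Hom.hom hab)

theorem isPullback_pullbackHom {Y' Y : E} (q : Y' ⟶ Y) {P Q : Pt Y} (g : P ⟶ Q) :
    IsPullback (pullback.fst P.f q) (pullbackHom q g) (Hom.hom g) (pullback.fst Q.f q) :=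
  .of_bot (by simpa using .of_hasPullback P.f q) (pullbackHom_fst q g).symm
    (.of_hasPullback Q.f q)

section BinaryProducts

variable {Y : E}

/-- The morphism of points induced by a square over `Y` which is cartesian in `E`. -/
noncomputable def liftOfIsPullback {P Q T R : Pt Y} {a : T ⟶ P} {b : T ⟶ Q}
    (h : IsPullback (Hom.hom a) (Hom.hom b) P.f Q.f) (c : R ⟶ P) (d : R ⟶ Q) : R ⟶ T where
  hom := h.lift (Hom.hom c) (Hom.hom d) (by simp)
  hom_f := by rw [← Hom.hom_f a, h.lift_fst_assoc, Hom.hom_f]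
  s_hom := by apply h.hom_ext <;> simp

/-- A span of points of `Y` whose square over `Y` is cartesian in `E` is a product in `Pt_Y(E)`. -/
noncomputable def isLimitOfIsPullback {P Q T : Pt Y} {a : T ⟶ P} {b : T ⟶ Q}
    (h : IsPullback (Hom.hom a) (Hom.hom b) P.f Q.f) : IsLimit (BinaryFan.mk a b) :=
  BinaryFan.isLimitMk (fun c => liftOfIsPullback h c.fst c.snd)
    (fun _ => hom_ext (h.lift_fst _ _ _)) (fun _ => hom_ext (h.lift_snd _ _ _))
    (fun _ _ h₁ h₂ => hom_ext (h.hom_ext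
      ((congrArg Hom.hom h₁).trans (h.lift_fst _ _ _).symm)
      ((congrArg Hom.hom h₂).trans (h.lift_snd _ _ _).symm)))

/-- The product of two points over `Y`, given by the fibre product over `Y`. -/
noncomputable def prod (P Q : Pt Y) : Pt Y where
  X := pullback P.f Q.f
  f := pullback.fst P.f Q.f ≫ P.f
  s := pullback.lift P.s Q.s (by simp)
  s_f := by simp

/-- The first projection of the product of two points. -/
noncomputable def prodFst (P Q : Pt Y) : prod P Q ⟶ P :=
  Hom.mk (pullback.fst _ _) rfl (pullback.lift_fst _ _ _)

/-- The second projection of the product of two points. -/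
noncomputable def prodSnd (P Q : Pt Y) : prod P Q ⟶ Q :=
  Hom.mk (pullback.snd _ _) pullback.condition.symm (pullback.lift_snd _ _ _)

theorem isPullback_prod (P Q : Pt Y) :
    IsPullback (Hom.hom (prodFst P Q)) (Hom.hom (prodSnd P Q)) P.f Q.f :=
  .of_hasPullback _ _

instance hasBinaryProducts : HasBinaryProducts (Pt Y) :=
  have (P Q : Pt Y) : HasLimit (pair P Q) := ⟨_, isLimitOfIsPullback (isPullback_prod P Q)⟩
  hasBinaryProducts_of_hasLimit_pair _

theorem isPullback_pullbackHom_pullbackHom {Y' : E} (q : Y' ⟶ Y) {P Q T : Pt Y} {a : T ⟶ P}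
    {b : T ⟶ Q} (h : IsPullback (Hom.hom a) (Hom.hom b) P.f Q.f) :
    IsPullback (pullbackHom q a) (pullbackHom q b) (pullback.snd P.f q) (pullback.snd Q.f q) := by
  refine .of_right ?_ (by simp) (.of_hasPullback P.f q)
  simpa [pullback.condition] using (isPullback_pullbackHom q b).paste_horiz h

instance baseChange_preservesBinaryProducts {Y' : E} (q : Y' ⟶ Y) :
    PreservesLimitsOfShape (Discrete WalkingPair) (baseChange q) :=
  have (P Q : Pt Y) : PreservesLimit (pair P Q) (baseChange q) :=
    preservesLimit_of_preserves_limit_cone (isLimitOfIsPullback (isPullback_prod P Q))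
      ((isLimitMapConeBinaryFanEquiv _ _ _).symm
        (isLimitOfIsPullback (isPullback_pullbackHom_pullbackHom q (isPullback_prod P Q))))
  ⟨fun {K} => preservesLimit_of_iso_diagram _ (diagramIsoPair K).symm⟩

end BinaryProducts

theorem exists_comp_eq_of_saturatedOnSubobjects {Y' Y : E} {q : Y' ⟶ Y}
    (hq : SaturatedOnSubobjects (baseChange q)) {P : Pt Y} {Z T : E} (ν : Z ⟶ pullback P.f q)
    [Mono ν] (s : Y' ⟶ Z) (hs : s ≫ ν = pullbackSection q P) (a : T ⟶ Z) (b : T ⟶ pullback P.f q)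
    (hab : a ≫ ν ≫ pullback.fst P.f q = b ≫ pullback.fst P.f q) : ∃ z : T ⟶ Z, z ≫ ν = b := by
  let S : Pt Y' := ⟨Z, ν ≫ pullback.snd P.f q, s, by rw [reassoc_of% hs, pullbackSection_snd]⟩
  let n : S ⟶ (baseChange q).obj P := Hom.mk ν rfl hs
  have : Mono (Hom.hom n) := inferInstanceAs (Mono ν)
  obtain ⟨W, m, e, -, he⟩ := hq P S n (mono_of_mono_hom n)
  let i : Z ⟶ pullback W.f q := Hom.hom e.hom
  let j : pullback W.f q ⟶ Z := Hom.hom e.inv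
  have hji : j ≫ i = 𝟙 _ := congrArg Hom.hom e.inv_hom_id
  have hi : i ≫ pullbackHom q m = ν := congrArg Hom.hom he
  have hm := isPullback_pullbackHom q m
  refine ⟨hm.lift (a ≫ i ≫ pullback.fst W.f q) b ?_ ≫ j, ?_⟩
  · rw [Category.assoc, Category.assoc, hm.w, reassoc_of% hi, hab]
  · simp only [← hi, Category.assoc, reassoc_of% hji, hm.lift_snd]

end HasPullbacks

section Regular

variable [Regular E] {Y' Y : E} (q : Y' ⟶ Y) [IsRegularEpi q]

instance baseChange_faithful : (baseChange q).Faithful where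
  map_injective {P Q g h} w := by
    have hgh : pullbackHom q g = pullbackHom q h := congrArg Hom.hom w
    apply hom_ext
    rw [← cancel_epi (pullback.fst P.f q), ← pullbackHom_fst, ← pullbackHom_fst, hgh]

instance baseChange_reflectsIsomorphisms : (baseChange q).ReflectsIsomorphisms where
  reflects {P Q} h _ := by
    have : IsIso (pullbackHom q h) := isIso_hom ((baseChange q).map h)
    have : Mono h := (baseChange q).mono_of_mono_map inferInstance
    have : Mono (Hom.hom h) := mono_hom h
    have : StrongEpi (pullback.fst P.f q ≫ Hom.hom h) := by
      rw [← pullbackHom_fst]; exact strongEpi_comp _ _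
    have : StrongEpi (Hom.hom h) := strongEpi_of_strongEpi (pullback.fst P.f q) (Hom.hom h)
    have : IsIso (Hom.hom h) := isIso_of_mono_of_strongEpi _
    exact isIso_of_isIso_hom h

variable {q} in
theorem exists_image_factorisation {Z : Pt Y'} {P : Pt Y} (φ : Z.X ⟶ P.X)
    (hf : φ ≫ P.f = Z.f ≫ q) (hs : Z.s ≫ φ = q ≫ P.s) :
    ∃ (W : Pt Y) (e : Z.X ⟶ W.X) (m : W ⟶ P), IsRegularEpi e ∧ Mono (Hom.hom m) ∧
      e ≫ Hom.hom m = φ ∧ e ≫ W.f = Z.f ≫ q ∧ Z.s ≫ e = q ≫ W.s := by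
  let F := Regular.strongEpiMonoFactorisation φ
  have sq : CommSq (Z.s ≫ F.e) q F.m P.s := ⟨by rw [Category.assoc, F.fac, hs]⟩
  refine ⟨⟨F.I, F.m ≫ P.f, sq.lift, by simp⟩, F.e, Hom.mk F.m rfl sq.fac_right,
    by dsimp only [F]; infer_instance, F.m_mono, F.fac, ?_, sq.fac_left.symm⟩
  rw [F.fac_assoc, hf]

theorem saturatedOnSubobjects_baseChange [IsMaltsev E] :
    SaturatedOnSubobjects (baseChange q) := by
  intro P Z n _
  let ν : Z.X ⟶ pullback P.f q := Hom.hom n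
  have hνf : ν ≫ pullback.snd P.f q = Z.f := Hom.hom_f n
  have hνs : Z.s ≫ ν = pullbackSection q P := Hom.s_hom n
  have : Mono ν := mono_hom n
  obtain ⟨W, e, m, _, _, he, hf, hs⟩ :=
    exists_image_factorisation (Z := Z) (P := P) (ν ≫ pullback.fst P.f q)
      (by rw [Category.assoc, pullback.condition, reassoc_of% hνf])
      (by rw [reassoc_of% hνs, pullbackSection_fst])
  have : JointlyMono₂ e Z.f := ⟨fun T x y h₁ h₂ => by
    rw [← cancel_mono ν]
    apply pullback.hom_ext
    · simp only [Category.assoc, ← he, reassoc_of% h₁]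
    · simpa only [Category.assoc, hνf] using h₂⟩
  have hW : IsPullback e Z.f W.f q :=
    (IsMaltsev.difunctional e Z.f).isPullback ⟨hf⟩ Z.s_f hs
  let i : Z ⟶ (baseChange q).obj W := Hom.mk hW.isoPullback.hom hW.isoPullback_hom_snd (by
    change Z.s ≫ hW.isoPullback.hom = pullbackSection q W
    apply pullback.hom_ext <;> simp [hs])
  have : IsIso (Hom.hom i) := inferInstanceAs (IsIso hW.isoPullback.hom)
  have : IsIso i := isIso_of_isIso_hom i
  refine ⟨W, m, asIso i, mono_of_mono_hom m, hom_ext (pullback.hom_ext ?_ ?_)⟩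
  · change (hW.isoPullback.hom ≫ pullbackHom q m) ≫ _ = ν ≫ _
    simp [he]
  · change (hW.isoPullback.hom ≫ pullbackHom q m) ≫ _ = ν ≫ _
    simp [hνf]

end Regular

end Pt

section Square

variable [HasFiniteLimits E] {R A B : E} (p : R ⟶ A) (q : R ⟶ B)

/-- The square of `X`, seen as a point of `X`: its first projection, split by the diagonal. -/
noncomputable abbrev Pt.square (X : E) : Pt X where
  X := X ⨯ X
  f := prod.fst
  s := diag X
  s_f := prod.lift_fst _ _

/-- The morphism `(r, r') ↦ ((p r, p r'), r)` from the kernel pair of `q` to the base change along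
`p` of the square of `A`. For a relation `(p, q)` it is monic, and exhibits as a subobject the pairs
`(a, r)` such that `a` is related to `q r`. -/
noncomputable def kernelPairToSquare : pullback q q ⟶ pullback (Pt.square A).f p :=
  pullback.lift (prod.lift (pullback.fst q q ≫ p) (pullback.snd q q ≫ p)) (pullback.fst q q)
    (prod.lift_fst _ _)

theorem kernelPairToSquare_fst : kernelPairToSquare p q ≫ pullback.fst (Pt.square A).f p =
    prod.lift (pullback.fst q q ≫ p) (pullback.snd q q ≫ p) :=
  pullback.lift_fst _ _ _

theorem kernelPairToSquare_fst_snd :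
    kernelPairToSquare p q ≫ pullback.fst (Pt.square A).f p ≫ prod.snd = pullback.snd q q ≫ p := by
  rw [reassoc_of% kernelPairToSquare_fst, prod.lift_snd]

theorem kernelPairToSquare_snd :
    kernelPairToSquare p q ≫ pullback.snd (Pt.square A).f p = pullback.fst q q :=
  pullback.lift_snd _ _ _

theorem diagonal_kernelPairToSquare :
    pullback.diagonal q ≫ kernelPairToSquare p q = Pt.pullbackSection p (Pt.square A) := by
  apply pullback.hom_ext
  · rw [Category.assoc, kernelPairToSquare_fst, Pt.pullbackSection_fst]
    ext <;> simp
  · rw [Category.assoc, kernelPairToSquare_snd, Pt.pullbackSection_snd, pullback.diagonal_fst]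

instance mono_kernelPairToSquare [JointlyMono₂ p q] : Mono (kernelPairToSquare p q) where
  right_cancellation x y h := by
    have hfst : x ≫ pullback.fst q q = y ≫ pullback.fst q q := by
      rw [← kernelPairToSquare_snd p, reassoc_of% h]
    refine pullback.hom_ext hfst (JointlyMono₂.right_cancellation (p₁ := p) (p₂ := q) _ _ ?_ ?_)
    · simp only [Category.assoc, ← kernelPairToSquare_fst_snd, reassoc_of% h]
    · simp only [Category.assoc, ← pullback.condition, reassoc_of% hfst]

theorem difunctional_of_saturatedOnSubobjects [JointlyMono₂ p q]
    (hp : SaturatedOnSubobjects (Pt.baseChange p)) : Difunctional p q := by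
  intro T w₁ w₂ w₃ hw₁₂ hw₂₃
  let b : T ⟶ pullback (Pt.square A).f p :=
    pullback.lift (prod.lift (w₂ ≫ p) (w₁ ≫ p)) w₃ ((prod.lift_fst _ _).trans hw₂₃)
  obtain ⟨z, hz⟩ := Pt.exists_comp_eq_of_saturatedOnSubobjects hp (kernelPairToSquare p q)
    (pullback.diagonal q) (diagonal_kernelPairToSquare p q) (pullback.lift w₂ w₁ hw₁₂.symm) b (by
      rw [kernelPairToSquare_fst, prod.comp_lift]
      simp [b])
  have hz₁ : z ≫ pullback.fst q q = w₃ := by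
    rw [← kernelPairToSquare_snd p, reassoc_of% hz, pullback.lift_snd]
  have hz₂ : z ≫ pullback.snd q q ≫ p = w₁ ≫ p := by
    rw [← kernelPairToSquare_fst_snd, reassoc_of% hz, pullback.lift_fst_assoc, prod.lift_snd]
  refine ⟨z ≫ pullback.snd q q, by rw [Category.assoc, hz₂], ?_⟩
  rw [Category.assoc, ← pullback.condition, reassoc_of% hz₁]

end Square

theorem isMaltsev_of_saturatedOnSubobjects [HasFiniteLimits E]
    (hE : ∀ {Y' Y : E} (q : Y' ⟶ Y), IsSplitEpi q → SaturatedOnSubobjects (Pt.baseChange q)) :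
    IsMaltsev E where
  isEquivalenceRelation p₁ p₂ h := by
    have : JointlyMono₂ p₁ p₂ := h.toJointlyMono₂
    have : IsSplitEpi p₁ := ⟨⟨h.r, h.reflexivity₁⟩⟩
    exact (difunctional_of_saturatedOnSubobjects p₁ p₂ (hE p₁ this)).isEquivalenceRelation h

end MaltsevCat

theorem mainTheorem7_general (E : Type u) [Category.{v} E] [Regular E] :
    List.TFAE [
      MaltsevCat.IsMaltsev E,
      ∀ {Y' Y : E} (q : Y' ⟶ Y), IsRegularEpi q →
        (MaltsevCat.Pt.baseChange q).Full ∧ (MaltsevCat.Pt.baseChange q).Faithful ∧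
          MaltsevCat.SaturatedOnSubobjects (MaltsevCat.Pt.baseChange q),
      ∀ {Y' Y : E} (q : Y' ⟶ Y), IsSplitEpi q →
        MaltsevCat.SaturatedOnSubobjects (MaltsevCat.Pt.baseChange q)] := by
  tfae_have 1 → 2 := fun _ _ _ q _ =>
    have hq := MaltsevCat.Pt.saturatedOnSubobjects_baseChange q
    ⟨hq.full, inferInstance, hq⟩
  tfae_have 2 → 3 := fun h _ _ q _ => (h q inferInstance).2.2
  tfae_have 3 → 1 := fun h => MaltsevCat.isMaltsev_of_saturatedOnSubobjects h
  tfae_finish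

theorem mainTheorem7 (E : Type u) [Category.{v} E] [Regular E] :
    MaltsevCat.IsMaltsev E ↔
      ∀ {Y' Y : E} (q : Y' ⟶ Y), IsRegularEpi q →
        (MaltsevCat.Pt.baseChange q).Full ∧ (MaltsevCat.Pt.baseChange q).Faithful ∧
          MaltsevCat.SaturatedOnSubobjects (MaltsevCat.Pt.baseChange q) :=
  (mainTheorem7_general E).out 0 1
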